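/- **Theorem.** Let $\mathcal X=\{x_1,\dots,x_N\}\subset\mathbb R^q$ be a finite design space and let $f:\mathcal X\to\mathbb R^p$ be such that $A=\sum_{x\in\mathcal X} f(x)f(x)^\top$ is invertible. For each $n\ge 1$ let $k_n(x)\ge 0$ $(x\in\mathcal X)$ be integers with $\sum_{x\in\mathcal X} k_n(x)=n$, and let $\xi_n=\sum_{x\in\mathcal X}\frac{k_n(x)}{n}\delta_x$ be the corresponding design measure. Suppose that at each $x$ one observes $$Y_j(x)=\mu_n(x)+\varepsilon_{x,j},\qquad j=1,\dots,k_n(x),$$ where $\mu_n:\mathcal X\to\mathbb R$ is the response function (so $\mu_n(x)=E[Y(x)]$ when the errors are integrable) and, for each $n$, the errors $\varepsilon_{x,j}$ are i.i.d. with a law, that of a variable $\varepsilon$, which is symmetric about $0$ and does not depend on $n$. Let the target parameter $\theta_0\in\mathbb R^p$ (the same for all $n$) satisfy $$\theta_0=\arg\min_{\eta}\sum_{x\in\mathcal X}\bigl(\mu_n(x)-f(x)^\top\eta\bigr)^2\quad(n\ge1),$$ put $\tau_n(x)=\mu_n(x)-f(x)^\top\theta_0$, and suppose that for a constant $\kappa$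 $$\sum_{x\in\mathcal X}\tau_n(x)^2\le \kappa^2/n\quad(n\ge1).$$ Let $\psi:\mathbb R\to\mathbb R$ be weakly increasing, odd and twice differentiable, let $\sigma>0$, put $\psi_\sigma(t)=\psi(t/\sigma)$, and suppose that $\psi_\sigma'$ and $\psi_\sigma''$ are bounded on $\mathbb R$ and that $$\sigma_M^2=\frac{E[\psi_\sigma(\varepsilon)^2]}{\bigl(E[\psi_\sigma'(\varepsilon)]\bigr)^2}$$ is finite, i.e. $E[\psi_\sigma(\varepsilon)^2]<\infty$ and $E[\psi_\sigma'(\varepsilon)]\neq0$. Let $$M_{0,n}=\int f(x)f(x)^\top\,\xi_n(dx),\qquad b_{0,n}=\int f(x)\,\tau_n(x)\,\xi_n(dx),$$ and suppose that there is a constant $c>0$ such that the smallest eigenvalue of $M_{0,n}$ is at least $c$ for all sufficiently large $n$, and that $\xi_n$ converges weakly to a probability measure $\xi_*$ on $\mathcal X$. For each $n$ let $\hat\theta_n$ be a random vector in $\mathbb R^p$ which almost surely solves the M-estimating equation $$\frac1n\sum_{x\in\mathcal X}\sum_{j=1}^{k_n(x)}\psi_\sigma\bigl(Y_j(x)-f(x)^\top\hat\theta_n\bigr)f(x)=0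 .$$ Then, as $n\to\infty$, $$\sqrt n\,M_{0,n}^{1/2}\bigl(\hat\theta_n-\theta_0-M_{0,n}^{-1}b_{0,n}\bigr)\ \xrightarrow{\ d\ }\ N\bigl(0,\sigma_M^2 I_p\bigr),$$ where $M_{0,n}^{1/2}$ is the positive semidefinite square root. -/

import Mathlib

open MeasureTheory ProbabilityTheory Filter Topology
open scoped NNReal ENNReal MatrixOrder RealInnerProductSpace

noncomputable section

namespace RobustDesign

/-- The rescaled score function `ψ_σ(t) = ψ(t / σ)`. -/
def scaledScore (ψ : ℝ → ℝ) (σ : ℝ) (t : ℝ) : ℝ := ψ (t / σ)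

/-- `σ_M² = E[ψ_σ(ε)²] / (E[ψ_σ'(ε)])²`, where the error `ε` has law `ν`. -/
def sigmaMSq (ψ : ℝ → ℝ) (σ : ℝ) (ν : Measure ℝ) : ℝ :=
  (∫ e, scaledScore ψ σ e ^ 2 ∂ν) / (∫ e, deriv (scaledScore ψ σ) e ∂ν) ^ 2

section Design

variable {X : Type*} [Fintype X] {p : ℕ}

/-- The design measure of an allocation of `k x` replicates to each design point `x`: it gives
mass `k x / n` to `x`, where `n = ∑ x, k x`.  (It is the zero measure if `n = 0`, and a
probability measure otherwise.) -/
def designMeasure [MeasurableSpace X] (k : X → ℕ) : FiniteMeasure X :=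
  ∑ x, ((k x : ℝ≥0) / ((∑ y, k y : ℕ) : ℝ≥0)) • (diracProba x).toFiniteMeasure

/-- The indices of the observations: pairs of a design point `x` and a replicate number. -/
abbrev Obs (k : X → ℕ) : Type _ := (x : X) × Fin (k x)

/-- `M₀(ξ) = ∫ f(x) f(x)ᵀ ξ(dx)`. -/
def momentMatrix [MeasurableSpace X] (f : X → EuclideanSpace ℝ (Fin p)) (ξ : FiniteMeasure X) :
    Matrix (Fin p) (Fin p) ℝ :=
  Matrix.of fun a b => ∫ x, f x a * f x b ∂(ξ : Measure X)

/-- `b₀(ξ) = ∫ f(x) τ(x) ξ(dx)`. -/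
def biasVector [MeasurableSpace X] (f : X → EuclideanSpace ℝ (Fin p)) (τ : X → ℝ)
    (ξ : FiniteMeasure X) : EuclideanSpace ℝ (Fin p) :=
  ∫ x, τ x • f x ∂(ξ : Measure X)

/-- The model error `τ(x) = m(x) - f(x)ᵀ θ` of the linear fit with parameter `θ` to the
response function `m`. -/
def modelError (f : X → EuclideanSpace ℝ (Fin p)) (m : X → ℝ) (θ : EuclideanSpace ℝ (Fin p))
    (x : X) : ℝ :=
  m x - ⟪f x, θ⟫

/-- The estimating function
`n⁻¹ ∑_{x, j} ψ_σ(Y_j(x) - f(x)ᵀ θ) f(x)`, with `n = ∑ x, k x`. -/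
def mEstimatingFunction (ψ : ℝ → ℝ) (σ : ℝ) (f : X → EuclideanSpace ℝ (Fin p)) (k : X → ℕ)
    (Y : Obs k → ℝ) (θ : EuclideanSpace ℝ (Fin p)) : EuclideanSpace ℝ (Fin p) :=
  (((∑ y, k y : ℕ) : ℝ)⁻¹) •
    ∑ x, ∑ j : Fin (k x), scaledScore ψ σ (Y ⟨x, j⟩ - ⟪f x, θ⟫) • f x

end Design

/-- The action of a `p × p` real matrix on Euclidean vectors. -/
def act {p : ℕ} (A : Matrix (Fin p) (Fin p) ℝ) (v : EuclideanSpace ℝ (Fin p)) :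
    EuclideanSpace ℝ (Fin p) :=
  Matrix.toEuclideanCLM (𝕜 := ℝ) A v

end RobustDesign

end

/-!
# Asymptotic normality of an M-estimator under a shrinking model error

Write `φ` for the rescaled score, `d = E φ'(ε) > 0`, `Δ = θhat - θ₀`, `S` for the sum of
`φ(ε_{xj}) f(x)` over all observations, `M` for the moment matrix and `b` for the bias vector.

* At a parameter within `K / √n` of `θ₀` all the shifts `τ(x) - f(x)ᵀ Δ` are `O(n^{-1/2})`, so a
  Taylor expansion turns the estimating function into `S + d n (b - M Δ)` up to `o(√n)`: the second
  order terms are bounded through `φ''`, and `φ'(ε)` may be replaced by its mean because the shifts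
  take one value per design point, so that a weak law of large numbers at each design point suffices
  (`norm_scoreSum_sub_linear_le`, `linearization_error_le`).
* Monotonicity of `φ` makes the estimating function monotone along rays from `θ₀`, while `c ≤ M`
  makes its linear part point inwards on the sphere of radius `K / √n`. Every root therefore lies
  inside that sphere, whatever root was selected, and solves the linearized equation
  (`norm_linearized_root_le`). Chebyshev's inequality makes this hold with probability tending to one
  (`tendsto_measureReal_linearized_root`).
* Applying `M^{-1/2}`, the normalized estimator is `d⁻¹ n^{-1/2} M^{-1/2} S + o_P(1)`. The leading
  term is a sum of independent variables with weights of size `O(n^{-1/2})` and covariance exactly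
  `σ_M² I`, so its characteristic function converges to the Gaussian one by a second order expansion
  of each factor (`tendsto_charFun_weighted_sum`). The remainder is invisible to characteristic
  functions (`tendsto_charFun_of_measureReal_sub`), and Lévy's theorem concludes.

The probability spaces vary with `n`, hence the direct arguments with characteristic functions in
place of Slutsky's theorem.
-/

namespace RobustDesign

/-! ### A central limit theorem for weighted sums, through characteristic functions -/

theorem norm_prod_sub_prod_le {ι : Type*} (s : Finset ι) (z w : ι → ℂ)
    (hz : ∀ i, ‖z i‖ ≤ 1) (hw : ∀ i, ‖w i‖ ≤ 1) :
    ‖∏ i ∈ s, z i - ∏ i ∈ s, w i‖ ≤ ∑ i ∈ s, ‖z i - w i‖ := by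
  classical
  induction s using Finset.induction_on with
  | empty => simp
  | insert a s ha ih =>
    rw [Finset.prod_insert ha, Finset.prod_insert ha, Finset.sum_insert ha]
    have hp : ‖∏ i ∈ s, w i‖ ≤ 1 := by
      rw [norm_prod]
      exact Finset.prod_le_one (fun i _ => norm_nonneg _) fun i _ => hw i
    calc ‖z a * ∏ i ∈ s, z i - w a * ∏ i ∈ s, w i‖
        = ‖(z a - w a) * ∏ i ∈ s, w i + z a * (∏ i ∈ s, z i - ∏ i ∈ s, w i)‖ := by
          congr 1; ring
      _ ≤ ‖z a - w a‖ * ‖∏ i ∈ s, w i‖ + ‖z a‖ * ‖∏ i ∈ s, z i - ∏ i ∈ s, w i‖ := by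
          refine (norm_add_le _ _).trans ?_
          rw [norm_mul, norm_mul]
      _ ≤ ‖z a - w a‖ * 1 + 1 * ‖∏ i ∈ s, z i - ∏ i ∈ s, w i‖ := by
          gcongr
          exact hz a
      _ ≤ _ := by linarith

/-- The second order expansion of the characteristic function of a centered law with finite,
possibly zero, second moment. -/
theorem charFun_sub_taylor_isLittleO (μ : Measure ℝ) [IsProbabilityMeasure μ]
    (h0 : ∫ x, x ∂μ = 0) (h2 : Integrable (fun x => x ^ 2) μ) :
    (fun s : ℝ => charFun μ s - (1 - ((∫ x, x ^ 2 ∂μ : ℝ) : ℂ) * (s : ℂ) ^ 2 / 2))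
      =o[𝓝 0] fun s : ℝ => s ^ 2 := by
  set v := ∫ x, x ^ 2 ∂μ with hv
  have hv0 : 0 ≤ v := integral_nonneg fun x => sq_nonneg x
  rcases hv0.eq_or_lt with hvz | hvp
  -- a centered law without variance is the Dirac mass at zero
  · have hae : (fun x : ℝ => x ^ 2) =ᵐ[μ] 0 :=
      (integral_eq_zero_iff_of_nonneg (fun x => sq_nonneg x) h2).1 (hv.symm.trans hvz.symm)
    have hcf : ∀ s : ℝ, charFun μ s = 1 := by
      intro s
      rw [charFun_apply_real]
      have : (fun x : ℝ => Complex.exp (s * x * Complex.I)) =ᵐ[μ] fun _ => (1 : ℂ) := by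
        filter_upwards [hae] with x hx
        have : x = 0 := by simpa using hx
        simp [this]
      rw [integral_congr_ae this]
      simp
    simp [hcf, ← hvz]
  · have hs : 0 < √v := Real.sqrt_pos.2 hvp
    have key := taylor_charFun_two (P := μ) (X := fun x => (√v)⁻¹ * x) (by fun_prop)
      (by rw [integral_const_mul, h0, mul_zero])
      (by
        simp only [Pi.pow_apply, mul_pow]
        rw [integral_const_mul, ← hv, inv_pow, Real.sq_sqrt hv0, inv_mul_cancel₀ hvp.ne'])
    have ht : Tendsto (fun s : ℝ => √v * s) (𝓝 0) (𝓝 0) := by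
      have : Continuous fun s : ℝ => √v * s := by fun_prop
      simpa using this.tendsto 0
    have key2 := key.comp_tendsto ht
    have hO : (fun s : ℝ => (√v * s) ^ 2) =O[𝓝 0] fun s : ℝ => s ^ 2 := by
      simp_rw [mul_pow]
      exact Asymptotics.isBigO_const_mul_self _ _ _
    refine (key2.trans_isBigO hO).congr_left fun s => ?_
    simp only [Function.comp]
    rw [charFun_map_mul, ← mul_assoc, inv_mul_cancel₀ hs.ne', one_mul]
    push_cast
    rw [mul_pow, ← Complex.ofReal_pow √v, Real.sq_sqrt hv0]

theorem charFun_sub_exp_isLittleO (μ : Measure ℝ) [IsProbabilityMeasure μ]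
    (h0 : ∫ x, x ∂μ = 0) (h2 : Integrable (fun x => x ^ 2) μ) :
    (fun s : ℝ => charFun μ s - Complex.exp (-(((∫ x, x ^ 2 ∂μ : ℝ) : ℂ) * (s : ℂ) ^ 2 / 2)))
      =o[𝓝 0] fun s : ℝ => s ^ 2 := by
  refine ((charFun_sub_taylor_isLittleO μ h0 h2).sub
    (?_ : (fun s : ℝ => Complex.exp (-(((∫ x, x ^ 2 ∂μ : ℝ) : ℂ) * (s : ℂ) ^ 2 / 2)) -
      (1 - ((∫ x, x ^ 2 ∂μ : ℝ) : ℂ) * (s : ℂ) ^ 2 / 2)) =o[𝓝 0] fun s : ℝ => s ^ 2)).congr_left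
      fun s => by ring
  set v := ∫ x, x ^ 2 ∂μ
  have hexp : (fun z : ℂ => Complex.exp z - 1 - z) =o[𝓝 0] fun z => z := by
    have := (Complex.hasDerivAt_exp 0).isLittleO
    simpa using this
  have ht : Tendsto (fun s : ℝ => -((v : ℂ) * (s : ℂ) ^ 2 / 2)) (𝓝 0) (𝓝 0) := by
    have : Continuous fun s : ℝ => -((v : ℂ) * (s : ℂ) ^ 2 / 2) := by fun_prop
    simpa using this.tendsto 0
  have hO : (fun s : ℝ => -((v : ℂ) * (s : ℂ) ^ 2 / 2)) =O[𝓝 0] fun s : ℝ => s ^ 2 := by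
    refine Asymptotics.IsBigO.of_bound (|v| / 2) (Eventually.of_forall fun s => ?_)
    simp only [norm_neg, norm_div, norm_mul, norm_pow, Complex.norm_real, Complex.norm_ofNat,
      Real.norm_eq_abs]
    apply le_of_eq; ring
  refine ((hexp.comp_tendsto ht).trans_isBigO hO).congr_left fun s => ?_
  simp only [Function.comp]
  ring

theorem charFun_map_smul_const {E : Type*} [NormedAddCommGroup E] [InnerProductSpace ℝ E]
    [MeasurableSpace E] [BorelSpace E] [SecondCountableTopology E]
    {Ω : Type*} [MeasurableSpace Ω] {P : Measure Ω} {X : Ω → ℝ} (hX : AEMeasurable X P)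
    (g t : E) :
    charFun (P.map fun ω => X ω • g) t = charFun (P.map X) ⟪g, t⟫ := by
  rw [charFun_apply, charFun_apply_real, integral_map (by fun_prop) (by fun_prop),
    integral_map hX (by fun_prop)]
  simp_rw [real_inner_smul_left]
  congr with ω
  push_cast
  ring_nf

/-- Central limit theorem, at the level of characteristic functions, for weighted sums of at most
`n` independent copies of a centered variable, when the weights are `O(n^{-1/2})` and their
second moment in the direction `t` converges. -/
theorem tendsto_charFun_weighted_sum {E : Type*} [NormedAddCommGroup E] [InnerProductSpace ℝ E]
    [MeasurableSpace E] [BorelSpace E] [SecondCountableTopology E]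
    (μ : Measure ℝ) [IsProbabilityMeasure μ]
    (h0 : ∫ x, x ∂μ = 0) (h2 : Integrable (fun x => x ^ 2) μ)
    {Ω : ℕ → Type*} [∀ n, MeasurableSpace (Ω n)] (P : ∀ n, Measure (Ω n))
    [∀ n, IsProbabilityMeasure (P n)]
    {ι : ℕ → Type*} [∀ n, Fintype (ι n)] (hcard : ∀ n, Fintype.card (ι n) ≤ n)
    (X : ∀ n, ι n → Ω n → ℝ) (hX : ∀ n i, HasLaw (X n i) μ (P n))
    (hind : ∀ n, iIndepFun (X n) (P n))
    (g : ∀ n, ι n → E) {C : ℝ} (hg : ∀ᶠ n : ℕ in atTop, ∀ i, ‖g n i‖ ≤ C / √n)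
    (t : E) {q : ℝ} (hq : Tendsto (fun n => ∑ i, ⟪g n i, t⟫ ^ 2) atTop (𝓝 q)) :
    Tendsto (fun n => charFun ((P n).map fun ω => ∑ i, X n i ω • g n i) t) atTop
      (𝓝 (Complex.exp (-(((∫ x, x ^ 2 ∂μ : ℝ) : ℂ) * (q : ℂ) / 2)))) := by
  set v := ∫ x, x ^ 2 ∂μ with hv
  have hv0 : 0 ≤ v := integral_nonneg fun x => sq_nonneg x
  set e : ℝ → ℂ := fun s => Complex.exp (-((v : ℂ) * (s : ℂ) ^ 2 / 2)) with he
  have he1 : ∀ s, ‖e s‖ ≤ 1 := by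
    intro s
    rw [he]
    have : (-((v : ℂ) * (s : ℂ) ^ 2 / 2)) = ((-(v * s ^ 2 / 2) : ℝ) : ℂ) := by push_cast; ring
    simp only [this, Complex.norm_exp_ofReal]
    exact Real.exp_le_one_iff.2 (by have := mul_nonneg hv0 (sq_nonneg s); linarith)
  have hcf : ∀ n, charFun ((P n).map fun ω => ∑ i, X n i ω • g n i) t
      = ∏ i, charFun μ ⟪g n i, t⟫ := by
    intro n
    have hm : ∀ i, AEMeasurable (X n i) (P n) := fun i => (hX n i).aemeasurable
    rw [iIndepFun.charFun_map_fun_sum_eq_prod (X := fun i ω => X n i ω • g n i)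
      (fun i => (hm i).smul_const _)
      ((hind n).comp (fun i x => x • g n i) (fun i => by fun_prop)), Finset.prod_apply]
    refine Finset.prod_congr rfl fun i _ => ?_
    rw [charFun_map_smul_const (hm i), (hX n i).map_eq]
  have hexp : Tendsto (fun n => ∏ i, e ⟪g n i, t⟫) atTop
      (𝓝 (Complex.exp (-((v : ℂ) * (q : ℂ) / 2)))) := by
    have : ∀ n, ∏ i, e ⟪g n i, t⟫
        = Complex.exp (-((v : ℂ) * ((∑ i, ⟪g n i, t⟫ ^ 2 : ℝ) : ℂ) / 2)) := by
      intro n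
      rw [he, ← Complex.exp_sum]
      congr 1
      push_cast
      rw [Finset.sum_neg_distrib, Finset.mul_sum, Finset.sum_div]
    simp_rw [this]
    have hc : Continuous fun y : ℝ => Complex.exp (-((v : ℂ) * (y : ℂ) / 2)) := by fun_prop
    exact (hc.tendsto q).comp hq
  have hdiff : Tendsto (fun n => ∏ i, charFun μ ⟪g n i, t⟫ - ∏ i, e ⟪g n i, t⟫) atTop (𝓝 0) := by
    rw [Metric.tendsto_atTop']
    intro η hη
    set D := (|C| * ‖t‖) ^ 2 + 1 with hD
    have hDp : 0 < D := by positivity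
    have hlo := (charFun_sub_exp_isLittleO μ h0 h2).def (c := η / (2 * D)) (by positivity)
    rw [Metric.eventually_nhds_iff] at hlo
    obtain ⟨δ, hδ, hloc⟩ := hlo
    have hsmall : Tendsto (fun n : ℕ => |C| * ‖t‖ / √(n : ℝ)) atTop (𝓝 0) :=
      Tendsto.div_atTop tendsto_const_nhds
        (Real.tendsto_sqrt_atTop.comp tendsto_natCast_atTop_atTop)
    obtain ⟨n₀, hn₀⟩ := eventually_atTop.1
      (hg.and ((hsmall.eventually_lt_const hδ).and (eventually_gt_atTop 0)))
    refine ⟨n₀, fun n hn => ?_⟩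
    obtain ⟨hgn, hsn, hnp⟩ := hn₀ n hn.le
    have hnp' : (0 : ℝ) < n := by exact_mod_cast hnp
    have hin : ∀ i, |⟪g n i, t⟫| ≤ |C| * ‖t‖ / √n := by
      intro i
      calc |⟪g n i, t⟫| ≤ ‖g n i‖ * ‖t‖ := abs_real_inner_le_norm _ _
        _ ≤ C / √n * ‖t‖ := by gcongr; exact hgn i
        _ ≤ |C| / √n * ‖t‖ := by gcongr; exact le_abs_self C
        _ = _ := by ring
    rw [dist_zero_right]
    refine (norm_prod_sub_prod_le _ _ _ (fun i => norm_charFun_le_one _) fun i => he1 _).trans_lt ?_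
    calc ∑ i, ‖charFun μ ⟪g n i, t⟫ - e ⟪g n i, t⟫‖
        ≤ ∑ _i : ι n, η / (2 * D) * (D / n) := by
          refine Finset.sum_le_sum fun i _ => ?_
          have h1 := hloc (y := ⟪g n i, t⟫) (by
            rw [Real.dist_eq, sub_zero]; exact (hin i).trans_lt hsn)
          refine h1.trans ?_
          gcongr
          rw [Real.norm_eq_abs, abs_pow]
          calc |⟪g n i, t⟫| ^ 2 ≤ (|C| * ‖t‖ / √n) ^ 2 := by gcongr; exact hin i
            _ = (|C| * ‖t‖) ^ 2 / n := by rw [div_pow, Real.sq_sqrt hnp'.le]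
            _ ≤ D / n := by gcongr; rw [hD]; linarith
      _ = Fintype.card (ι n) * (η / (2 * n)) := by
          rw [Finset.sum_const, nsmul_eq_mul, Finset.card_univ]
          field_simp
      _ ≤ n * (η / (2 * n)) := by gcongr; exact hcard n
      _ = η / 2 := by field_simp
      _ < η := by linarith
  simp_rw [hcf]
  simpa using hdiff.add hexp

/-- Characteristic functions do not see a perturbation that tends to zero in probability (with a
probability space that may change with the index). -/
theorem tendsto_charFun_of_measureReal_sub {E : Type*} [NormedAddCommGroup E]
    [InnerProductSpace ℝ E] [MeasurableSpace E] [BorelSpace E] [SecondCountableTopology E]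
    {Ω : ℕ → Type*} [∀ n, MeasurableSpace (Ω n)] (P : ∀ n, Measure (Ω n))
    [∀ n, IsProbabilityMeasure (P n)] {X Y : ∀ n, Ω n → E}
    (hX : ∀ n, AEMeasurable (X n) (P n)) (hY : ∀ n, AEMeasurable (Y n) (P n))
    (hXY : ∀ η > 0, Tendsto (fun n => (P n).real {ω | η < ‖X n ω - Y n ω‖}) atTop (𝓝 0))
    (t : E) {z : ℂ} (hz : Tendsto (fun n => charFun ((P n).map (Y n)) t) atTop (𝓝 z)) :
    Tendsto (fun n => charFun ((P n).map (X n)) t) atTop (𝓝 z) := by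
  have hcf : ∀ n (Z : Ω n → E), AEMeasurable Z (P n) →
      charFun ((P n).map Z) t = ∫ ω, Complex.exp (⟪Z ω, t⟫ * Complex.I) ∂(P n) := by
    intro n Z hZ
    rw [charFun_apply, integral_map hZ (by fun_prop)]
  have hint : ∀ n (Z : Ω n → E), AEMeasurable Z (P n) →
      Integrable (fun ω => Complex.exp (⟪Z ω, t⟫ * Complex.I)) (P n) := by
    intro n Z hZ
    refine Integrable.of_bound (C := 1) ?_ (Eventually.of_forall fun ω => ?_)
    · exact AEMeasurable.aestronglyMeasurable (by fun_prop)
    · rw [Complex.norm_exp_ofReal_mul_I]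
  -- the integrands differ by at most `η ‖t‖` off the event `η < ‖X - Y‖`, and by at most `2` on it
  suffices h : Tendsto (fun n => charFun ((P n).map (X n)) t - charFun ((P n).map (Y n)) t)
      atTop (𝓝 0) by simpa using h.add hz
  rw [Metric.tendsto_atTop']
  intro ζ hζ
  set η := ζ / (2 * (‖t‖ + 1)) with hη
  have hηp : 0 < η := by positivity
  obtain ⟨n₀, hn₀⟩ := eventually_atTop.1
    ((hXY η hηp).eventually_lt_const (show (0 : ℝ) < ζ / 4 by positivity))
  refine ⟨n₀, fun n hn => ?_⟩
  have hbad := hn₀ n hn.le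
  set B := {ω | η < ‖X n ω - Y n ω‖} with hB
  have hBm : NullMeasurableSet B (P n) :=
    nullMeasurableSet_lt aemeasurable_const ((hX n).sub (hY n)).norm
  rw [dist_zero_right, hcf n _ (hX n), hcf n _ (hY n), ← integral_sub (hint n _ (hX n))
    (hint n _ (hY n))]
  have hpt : ∀ ω, ‖Complex.exp (⟪X n ω, t⟫ * Complex.I) - Complex.exp (⟪Y n ω, t⟫ * Complex.I)‖
      ≤ η * ‖t‖ + B.indicator (fun _ => (2 : ℝ)) ω := by
    intro ω
    by_cases hω : ω ∈ B
    · rw [Set.indicator_of_mem hω]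
      have h2 : ‖Complex.exp (⟪X n ω, t⟫ * Complex.I) - Complex.exp (⟪Y n ω, t⟫ * Complex.I)‖
          ≤ 1 + 1 := by
        refine (norm_sub_le _ _).trans ?_
        rw [Complex.norm_exp_ofReal_mul_I, Complex.norm_exp_ofReal_mul_I]
      have : 0 ≤ η * ‖t‖ := by positivity
      linarith
    · rw [Set.indicator_of_notMem hω, add_zero]
      have hle : ‖X n ω - Y n ω‖ ≤ η := not_lt.1 hω
      have hfac : Complex.exp (⟪X n ω, t⟫ * Complex.I) - Complex.exp (⟪Y n ω, t⟫ * Complex.I)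
          = Complex.exp (⟪Y n ω, t⟫ * Complex.I) *
            (Complex.exp (Complex.I * (⟪X n ω - Y n ω, t⟫ : ℝ)) - 1) := by
        rw [mul_sub, mul_one, ← Complex.exp_add, inner_sub_left]
        push_cast
        ring_nf
      rw [hfac, norm_mul, Complex.norm_exp_ofReal_mul_I, one_mul]
      refine (Real.norm_exp_I_mul_ofReal_sub_one_le).trans ?_
      rw [Real.norm_eq_abs]
      refine (abs_real_inner_le_norm _ _).trans ?_
      gcongr
  have hind : Integrable (B.indicator fun _ => (2 : ℝ)) (P n) :=
    (integrable_const _).indicator₀ hBm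
  refine (norm_integral_le_of_norm_le ((integrable_const _).add hind)
    (Eventually.of_forall hpt)).trans_lt ?_
  simp only [Pi.add_apply]
  rw [integral_add (integrable_const _) hind, integral_indicator₀ hBm, integral_const,
    setIntegral_const, probReal_univ, one_smul, smul_eq_mul]
  have : η * ‖t‖ ≤ ζ / 2 := by
    rw [hη, div_mul_eq_mul_div, div_le_div_iff₀ (by positivity) (by positivity)]
    nlinarith [norm_nonneg t]
  linarith

/-- Chebyshev's inequality for a sum of independent copies of a centered variable. -/
theorem measureReal_sum_ge_le {Ω ι : Type*} [MeasurableSpace Ω] {P : Measure Ω}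
    [IsProbabilityMeasure P] {ν : Measure ℝ} {ε : ι → Ω → ℝ}
    (hlaw : ∀ i, HasLaw (ε i) ν P) (hind : iIndepFun ε P) {φ : ℝ → ℝ} (hφ : Measurable φ)
    (h0 : ∫ e, φ e ∂ν = 0) (h2 : Integrable (fun e => φ e ^ 2) ν) (s : Finset ι) {a : ℝ}
    (ha : 0 < a) :
    P.real {ω | a ≤ |∑ i ∈ s, φ (ε i ω)|} ≤ s.card * (∫ e, φ e ^ 2 ∂ν) / a ^ 2 := by
  have hm : ∀ i, AEMeasurable (ε i) P := fun i => (hlaw i).aemeasurable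
  have hL2 : ∀ i, MemLp (fun ω => φ (ε i ω)) 2 P := by
    intro i
    refine (memLp_two_iff_integrable_sq (hφ.comp_aemeasurable (hm i)).aestronglyMeasurable).2 ?_
    rw [← (hlaw i).map_eq] at h2
    exact h2.comp_aemeasurable (hm i)
  have hmean : ∀ i, ∫ ω, φ (ε i ω) ∂P = 0 := by
    intro i
    rw [← h0]
    exact (hlaw i).integral_comp hφ.aestronglyMeasurable
  have hsq : ∀ i, ∫ ω, φ (ε i ω) ^ 2 ∂P = ∫ e, φ e ^ 2 ∂ν := fun i =>
    (hlaw i).integral_comp (f := fun e => φ e ^ 2) (hφ.pow_const 2).aestronglyMeasurable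
  have hvar : Var[fun ω => ∑ i ∈ s, φ (ε i ω); P] = s.card * ∫ e, φ e ^ 2 ∂ν := by
    have h := IndepFun.variance_sum (s := s) (X := fun i ω => φ (ε i ω)) (μ := P)
      (fun i _ => hL2 i)
      (fun i _ j _ hij => (hind.comp (fun _ => φ) fun _ => hφ).indepFun hij)
    have h' : (∑ i ∈ s, fun ω => φ (ε i ω)) = fun ω => ∑ i ∈ s, φ (ε i ω) := by
      ext ω; simp
    rw [h'] at h
    rw [h, Finset.sum_congr rfl fun i _ => by
      rw [variance_of_integral_eq_zero (hL2 i).1.aemeasurable (hmean i), hsq i],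
      Finset.sum_const, nsmul_eq_mul]
  have hmean' : ∫ ω, ∑ i ∈ s, φ (ε i ω) ∂P = 0 := by
    rw [integral_finsetSum _ fun i _ => (hL2 i).integrable (by norm_num)]
    simp [hmean]
  have hch := meas_ge_le_variance_div_sq (X := fun ω => ∑ i ∈ s, φ (ε i ω)) (μ := P)
    (memLp_finsetSum s fun i _ => hL2 i) ha
  rw [hmean', hvar] at hch
  simp only [sub_zero] at hch
  have hnn : 0 ≤ s.card * (∫ e, φ e ^ 2 ∂ν) / a ^ 2 := by
    have : 0 ≤ ∫ e, φ e ^ 2 ∂ν := integral_nonneg fun e => sq_nonneg _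
    positivity
  exact ENNReal.toReal_le_of_le_ofReal hnn hch

/-! ### Deterministic analysis of the estimating equation -/

theorem abs_sub_taylor_le {φ : ℝ → ℝ} (hφ : Differentiable ℝ φ)
    (hφ' : Differentiable ℝ (deriv φ)) {m : ℝ} (hm : ∀ t, |deriv (deriv φ) t| ≤ m) (x u : ℝ) :
    |φ (x + u) - φ x - u * deriv φ x| ≤ m * u ^ 2 := by
  have hlip : ∀ y, |deriv φ y - deriv φ x| ≤ m * |y - x| := fun y =>
    convex_univ.norm_image_sub_le_of_norm_deriv_le (fun z _ => hφ' z) (fun z _ => hm z)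
      (Set.mem_univ x) (Set.mem_univ y)
  have hm0 : 0 ≤ m := (abs_nonneg _).trans (hm 0)
  have hd : ∀ y, HasDerivAt (fun y => φ y - y * deriv φ x) (deriv φ y - deriv φ x) y := by
    intro y
    have h := (hφ y).hasDerivAt.sub ((hasDerivAt_id y).mul_const (deriv φ x))
    rw [one_mul] at h
    exact h
  have h := (convex_closedBall x |u|).norm_image_sub_le_of_norm_hasDerivWithin_le
    (f := fun y => φ y - y * deriv φ x) (C := m * |u|) (x := x) (y := x + u)
    (fun y _ => (hd y).hasDerivWithinAt)
    (fun y hy => (hlip y).trans (mul_le_mul_of_nonneg_left hy hm0))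
    (Metric.mem_closedBall_self (abs_nonneg u)) (show |x + u - x| ≤ |u| by simp)
  calc |φ (x + u) - φ x - u * deriv φ x|
      = ‖(φ (x + u) - (x + u) * deriv φ x) - (φ x - x * deriv φ x)‖ := by
        rw [Real.norm_eq_abs]; congr 1; ring
    _ ≤ m * |u| * ‖x + u - x‖ := h
    _ = m * u ^ 2 := by
        rw [add_sub_cancel_left, Real.norm_eq_abs, mul_assoc, ← sq, sq_abs]

section ScoreSum

variable {X : Type*} [Fintype X] {E : Type*} [NormedAddCommGroup E] [InnerProductSpace ℝ E]

/-- Linearization of the estimating function.  The shifts `u x` are common to all replicates at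
`x`, so the fluctuation of `φ'` enters only through its sums over replicates. -/
theorem norm_scoreSum_sub_linear_le {φ : ℝ → ℝ} (hφ : Differentiable ℝ φ)
    (hφ' : Differentiable ℝ (deriv φ)) {m : ℝ} (hm : ∀ t, |deriv (deriv φ) t| ≤ m) (d : ℝ)
    (f : X → E) (k : X → ℕ) (e : Obs k → ℝ) (u : X → ℝ) :
    ‖(∑ x, ∑ j, φ (e ⟨x, j⟩ + u x) • f x) - ((∑ x, (∑ j, φ (e ⟨x, j⟩)) • f x) +
        d • ∑ x, (k x * u x) • f x)‖
      ≤ ∑ x, (|∑ j, (deriv φ (e ⟨x, j⟩) - d)| * |u x| + k x * (m * u x ^ 2)) * ‖f x‖ := by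
  have hpt : (∑ x, ∑ j, φ (e ⟨x, j⟩ + u x) • f x) - ((∑ x, (∑ j, φ (e ⟨x, j⟩)) • f x) +
        d • ∑ x, (k x * u x) • f x)
      = ∑ x, ((∑ j, (deriv φ (e ⟨x, j⟩) - d)) * u x +
          ∑ j, (φ (e ⟨x, j⟩ + u x) - φ (e ⟨x, j⟩) - u x * deriv φ (e ⟨x, j⟩))) • f x := by
    rw [Finset.smul_sum, ← Finset.sum_add_distrib, ← Finset.sum_sub_distrib]
    refine Finset.sum_congr rfl fun x _ => ?_
    rw [← Finset.sum_smul, smul_smul, ← add_smul, ← sub_smul]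
    congr 1
    simp only [Finset.sum_sub_distrib, Finset.sum_const, Finset.card_univ, Fintype.card_fin,
      nsmul_eq_mul, ← Finset.mul_sum]
    ring
  rw [hpt]
  refine (norm_sum_le _ _).trans (Finset.sum_le_sum fun x _ => ?_)
  rw [norm_smul, Real.norm_eq_abs]
  gcongr
  refine (abs_add_le _ _).trans ?_
  rw [abs_mul]
  gcongr
  refine (Finset.abs_sum_le_sum_abs _ _).trans ?_
  refine (Finset.sum_le_sum fun j _ => abs_sub_taylor_le hφ hφ' hm (e ⟨x, j⟩) (u x)).trans ?_
  simp

theorem natCast_mul_div_sqrt (n : ℕ) (y : ℝ) : (n : ℝ) * (y / √n) = √n * y := by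
  rw [mul_div_left_comm, Real.div_sqrt, mul_comm]

/-- The error bound of `norm_scoreSum_sub_linear_le` when the shifts are at most `U / √n` and the
fluctuations `Q x` of the sums of `φ'` are at most `ρ n`. -/
theorem linearization_error_le {G : Type*} [NormedAddCommGroup G] {n : ℕ} (hn : 0 < n)
    {k : X → ℕ} (hk : ∑ x, k x = n) {f : X → G} {F : ℝ} (hF : ∀ x, ‖f x‖ ≤ F) (hF0 : 0 ≤ F) {U ρ m : ℝ}
    (hm : 0 ≤ m) (hρ : 0 ≤ ρ) {Q u : X → ℝ} (hQ : ∀ x, |Q x| ≤ ρ * n) (hu : ∀ x, |u x| ≤ U / √n) :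
    ∑ x, (|Q x| * |u x| + k x * (m * u x ^ 2)) * ‖f x‖
      ≤ √n * (Fintype.card X * F * U * ρ + F * m * U ^ 2 / √n) := by
  have hs : 0 < √(n : ℝ) := Real.sqrt_pos.2 (by exact_mod_cast hn)
  have hterm : ∀ x, (|Q x| * |u x| + k x * (m * u x ^ 2)) * ‖f x‖
      ≤ √n * F * U * ρ + k x * (m * U ^ 2 / n * F) := by
    intro x
    have h1 : |Q x| * |u x| ≤ ρ * n * (U / √n) := by
      gcongr
      · exact hQ x
      · exact hu x
    have h2 : u x ^ 2 ≤ U ^ 2 / n := by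
      rw [← sq_abs]
      calc |u x| ^ 2 ≤ (U / √n) ^ 2 := by gcongr; exact hu x
        _ = U ^ 2 / n := by rw [div_pow, Real.sq_sqrt (Nat.cast_nonneg n)]
    calc (|Q x| * |u x| + k x * (m * u x ^ 2)) * ‖f x‖
        ≤ (ρ * n * (U / √n) + k x * (m * (U ^ 2 / n))) * F := by
          have : 0 ≤ ρ * n * (U / √n) := (by positivity : 0 ≤ |Q x| * |u x|).trans h1
          gcongr
          exact hF x
      _ = √n * F * U * ρ + k x * (m * U ^ 2 / n * F) := by
          rw [mul_assoc ρ, natCast_mul_div_sqrt]; ring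
  refine (Finset.sum_le_sum fun x _ => hterm x).trans (le_of_eq ?_)
  rw [Finset.sum_add_distrib, Finset.sum_const, ← Finset.sum_mul, ← Nat.cast_sum, hk,
    Finset.card_univ, nsmul_eq_mul]
  have hn' : (n : ℝ) ≠ 0 := by positivity
  field_simp

/-- Monotonicity of the score makes the estimating function monotone along rays: shrinking a root
towards the origin leaves the inner product with the root nonnegative. -/
theorem inner_scoreSum_smul_nonneg {φ : ℝ → ℝ} (hφ : Monotone φ) {f : X → E} {k : X → ℕ}
    {y : Obs k → ℝ} {Δ : E} (h0 : ∑ x, ∑ j, φ (y ⟨x, j⟩ - ⟪f x, Δ⟫) • f x = 0)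
    {r : ℝ} (hr : r ≤ 1) :
    0 ≤ ⟪∑ x, ∑ j, φ (y ⟨x, j⟩ - ⟪f x, r • Δ⟫) • f x, Δ⟫ := by
  have h1 : ⟪∑ x, ∑ j, φ (y ⟨x, j⟩ - ⟪f x, Δ⟫) • f x, Δ⟫ = 0 := by rw [h0, inner_zero_left]
  rw [← h1]
  simp only [sum_inner, real_inner_smul_left, real_inner_smul_right]
  refine Finset.sum_le_sum fun x _ => Finset.sum_le_sum fun j _ => ?_
  rcases le_total 0 ⟪f x, Δ⟫ with h | h
  · exact mul_le_mul_of_nonneg_right (hφ (by nlinarith)) h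
  · exact mul_le_mul_of_nonpos_right (hφ (by nlinarith)) h

/-- Any root of a monotone estimating equation is within `K / √n` of the origin, and solves the
linearized equation up to `√n * R`, as soon as the linear part dominates on the sphere of radius
`K / √n`. -/
theorem norm_linearized_root_le {φ : ℝ → ℝ} (hmono : Monotone φ) (hφ : Differentiable ℝ φ)
    (hφ' : Differentiable ℝ (deriv φ)) {m : ℝ} (hm : ∀ t, |deriv (deriv φ) t| ≤ m)
    {d : ℝ} (hd : 0 ≤ d) {n : ℕ} (hn : 0 < n) {k : X → ℕ} (hk : ∑ x, k x = n)
    {f : X → E} {F : ℝ} (hF : ∀ x, ‖f x‖ ≤ F) (hF0 : 0 ≤ F)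
    {c : ℝ} (hc : ∀ h, c * n * ‖h‖ ^ 2 ≤ ∑ x, k x * ⟪f x, h⟫ ^ 2)
    {τ : X → ℝ} {κ : ℝ} (hτ : ∀ x, |τ x| ≤ κ / √n) {ρ a K R : ℝ} (hρ : 0 ≤ ρ)
    (hK : 0 < K)
    (hR : Fintype.card X * F * (κ + F * K) * ρ + F * m * (κ + F * K) ^ 2 / √n ≤ R)
    (hdom : a + R + d * κ * F < d * c * K)
    {e : Obs k → ℝ} (hS : ‖∑ x, (∑ j, φ (e ⟨x, j⟩)) • f x‖ ≤ a * √n)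
    (hQ : ∀ x, |∑ j, (deriv φ (e ⟨x, j⟩) - d)| ≤ ρ * n)
    {Δ : E} (h0 : ∑ x, ∑ j, φ (e ⟨x, j⟩ + τ x - ⟪f x, Δ⟫) • f x = 0) :
    ‖(∑ x, (∑ j, φ (e ⟨x, j⟩)) • f x) + d • ∑ x, (k x * (τ x - ⟪f x, Δ⟫)) • f x‖ ≤ √n * R := by
  have hs : 0 < √(n : ℝ) := Real.sqrt_pos.2 (by exact_mod_cast hn)
  have hss : √(n : ℝ) * √n = n := Real.mul_self_sqrt (Nat.cast_nonneg n)
  have hm0 : 0 ≤ m := (abs_nonneg _).trans (hm 0)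
  set S := ∑ x, (∑ j, φ (e ⟨x, j⟩)) • f x with hSdef
  have hlin : ∀ h : E, ‖h‖ ≤ K / √n →
      ‖(∑ x, ∑ j, φ (e ⟨x, j⟩ + τ x - ⟪f x, h⟫) • f x) -
        (S + d • ∑ x, (k x * (τ x - ⟪f x, h⟫)) • f x)‖ ≤ √n * R := by
    intro h hh
    have hu : ∀ x, |τ x - ⟪f x, h⟫| ≤ (κ + F * K) / √n := by
      intro x
      calc |τ x - ⟪f x, h⟫| ≤ |τ x| + |⟪f x, h⟫| := abs_sub _ _
        _ ≤ κ / √n + F * (K / √n) := by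
          gcongr
          · exact hτ x
          · refine (abs_real_inner_le_norm _ _).trans ?_
            gcongr
            exact hF x
        _ = _ := by ring
    simp_rw [add_sub_assoc]
    refine (norm_scoreSum_sub_linear_le hφ hφ' hm d f k e (fun x => τ x - ⟪f x, h⟫)).trans ?_
    refine (linearization_error_le hn hk hF hF0 hm0 hρ hQ hu).trans ?_
    gcongr
  have hΔ : ‖Δ‖ ≤ K / √n := by
    by_contra! hcon
    -- shrink the root to the point `h` of the sphere of radius `K / √n`
    have hKs : 0 < K / √n := by positivity
    have hΔp : 0 < ‖Δ‖ := hKs.trans hcon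
    set r := K / √n / ‖Δ‖ with hr
    have hrp : 0 < r := by positivity
    have hr1 : r ≤ 1 := (div_le_one hΔp).2 hcon.le
    set h := r • Δ with hh
    have hnorm : ‖h‖ = K / √n := by
      rw [hh, norm_smul, Real.norm_eq_abs, abs_of_pos hrp, hr, div_mul_cancel₀ _ hΔp.ne']
    have hpos : 0 ≤ ⟪∑ x, ∑ j, φ (e ⟨x, j⟩ + τ x - ⟪f x, h⟫) • f x, h⟫ := by
      have := inner_scoreSum_smul_nonneg hmono (y := fun i => e i + τ i.1) h0 hr1
      rw [hh, real_inner_smul_right _ Δ]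
      exact mul_nonneg hrp.le this
    have hl := hlin h hnorm.le
    set Ψ := ∑ x, ∑ j, φ (e ⟨x, j⟩ + τ x - ⟪f x, h⟫) • f x with hΨ
    set T := ∑ x, (k x * (τ x - ⟪f x, h⟫)) • f x with hT
    have hT' : ⟪T, h⟫ ≤ √n * κ * F * ‖h‖ - c * n * ‖h‖ ^ 2 := by
      have h1 : ⟪T, h⟫ = ∑ x, k x * (τ x * ⟪f x, h⟫) - ∑ x, k x * ⟪f x, h⟫ ^ 2 := by
        rw [hT, sum_inner, ← Finset.sum_sub_distrib]
        refine Finset.sum_congr rfl fun x _ => ?_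
        rw [real_inner_smul_left]; ring
      have h2 : ∑ x, k x * (τ x * ⟪f x, h⟫) ≤ ∑ x, (k x : ℝ) * (κ / √n * (F * ‖h‖)) := by
        refine Finset.sum_le_sum fun x _ => ?_
        refine mul_le_mul_of_nonneg_left ((le_abs_self _).trans ?_) (Nat.cast_nonneg _)
        rw [abs_mul]
        refine mul_le_mul (hτ x) ((abs_real_inner_le_norm _ _).trans ?_) (abs_nonneg _)
          ((abs_nonneg _).trans (hτ x))
        gcongr
        exact hF x
      rw [← Finset.sum_mul, ← Nat.cast_sum, hk] at h2
      have h3 : (n : ℝ) * (κ / √n * (F * ‖h‖)) = √n * κ * F * ‖h‖ := by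
        rw [← mul_assoc, natCast_mul_div_sqrt]; ring
      linarith [hc h]
    have hdecomp : ⟪Ψ, h⟫ = ⟪Ψ - (S + d • T), h⟫ + ⟪S, h⟫ + d * ⟪T, h⟫ := by
      rw [inner_sub_left, inner_add_left, real_inner_smul_left]; ring
    have h1 : ⟪Ψ - (S + d • T), h⟫ ≤ √n * R * ‖h‖ :=
      (real_inner_le_norm _ _).trans (by gcongr)
    have h2 : ⟪S, h⟫ ≤ a * √n * ‖h‖ := (real_inner_le_norm _ _).trans (by gcongr)
    have h3 : d * ⟪T, h⟫ ≤ d * (√n * κ * F * ‖h‖ - c * n * ‖h‖ ^ 2) := by gcongr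
    have h4 : (n : ℝ) * ‖h‖ ^ 2 = √n * ‖h‖ * K := by
      rw [hnorm, sq, ← mul_assoc, natCast_mul_div_sqrt]; ring
    -- monotonicity says `0 ≤ ⟪Ψ, h⟫`, the linearization and `hdom` say `⟪Ψ, h⟫ < 0`
    have h5 : 0 ≤ √n * ‖h‖ * (a + R + d * κ * F - d * c * K) := by
      calc 0 ≤ ⟪Ψ, h⟫ := hpos
        _ ≤ √n * R * ‖h‖ + a * √n * ‖h‖ + d * (√n * κ * F * ‖h‖ - c * n * ‖h‖ ^ 2) := by
          linarith
        _ = _ := by rw [mul_assoc c, h4]; ring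
    have h6 : 0 < √n * ‖h‖ := by rw [hnorm]; positivity
    nlinarith
  have := hlin Δ hΔ
  rwa [h0, zero_sub, norm_neg] at this

end ScoreSum

/-! ### The moment matrix of a design and its square root -/

section Moment

variable {X : Type*} [Fintype X] [MeasurableSpace X] [MeasurableSingletonClass X] {p : ℕ}

theorem integral_designMeasure {G : Type*} [NormedAddCommGroup G] [NormedSpace ℝ G]
    [CompleteSpace G] (k : X → ℕ) {n : ℕ} (hk : ∑ x, k x = n) (g : X → G) :
    ∫ x, g x ∂(designMeasure k : Measure X) = ∑ x, ((k x : ℝ) / n) • g x := by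
  have h : (designMeasure k : Measure X) =
      ∑ x, ((k x : ℝ≥0) / (n : ℝ≥0)) • Measure.dirac x := by
    rw [designMeasure, hk, FiniteMeasure.toMeasure_sum]
    rfl
  rw [h, integral_finsetSum_measure fun x _ => (integrable_dirac (by simp)).smul_measure_nnreal]
  refine Finset.sum_congr rfl fun x _ => ?_
  rw [integral_smul_nnreal_measure, integral_dirac]
  rfl

theorem biasVector_designMeasure (f : X → EuclideanSpace ℝ (Fin p)) (τ : X → ℝ) (k : X → ℕ)
    {n : ℕ} (hk : ∑ x, k x = n) :
    biasVector f τ (designMeasure k) = ∑ x, ((k x : ℝ) / n) • τ x • f x :=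
  integral_designMeasure k hk _

theorem act_momentMatrix (f : X → EuclideanSpace ℝ (Fin p)) (k : X → ℕ)
    {n : ℕ} (hk : ∑ x, k x = n) (h : EuclideanSpace ℝ (Fin p)) :
    act (momentMatrix f (designMeasure k)) h = ∑ x, ((k x : ℝ) / n) • ⟪f x, h⟫ • f x := by
  ext a
  simp only [act, Matrix.ofLp_toEuclideanCLM, Matrix.mulVec, dotProduct, momentMatrix,
    Matrix.of_apply, integral_designMeasure k hk, WithLp.ofLp_sum, Finset.sum_apply,
    WithLp.ofLp_smul, Pi.smul_apply, smul_eq_mul, PiLp.inner_apply, Finset.sum_mul,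
    Finset.mul_sum]
  rw [Finset.sum_comm]
  refine Finset.sum_congr rfl fun x _ => Finset.sum_congr rfl fun b _ => ?_
  simp
  ring

theorem inner_act_momentMatrix (f : X → EuclideanSpace ℝ (Fin p)) (k : X → ℕ)
    {n : ℕ} (hk : ∑ x, k x = n) (h : EuclideanSpace ℝ (Fin p)) :
    ⟪act (momentMatrix f (designMeasure k)) h, h⟫ = ∑ x, ((k x : ℝ) / n) * ⟪f x, h⟫ ^ 2 := by
  rw [act_momentMatrix f k hk, sum_inner]
  refine Finset.sum_congr rfl fun x _ => ?_
  rw [real_inner_smul_left, real_inner_smul_left]; ring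

theorem inner_act_eq_dotProduct (A : Matrix (Fin p) (Fin p) ℝ) (h : EuclideanSpace ℝ (Fin p)) :
    ⟪act A h, h⟫ = h.ofLp ⬝ᵥ A.mulVec h.ofLp := by
  simp [act, EuclideanSpace.inner_eq_star_dotProduct]

theorem posSemidef_momentMatrix (f : X → EuclideanSpace ℝ (Fin p)) (k : X → ℕ)
    {n : ℕ} (hk : ∑ x, k x = n) : (momentMatrix f (designMeasure k)).PosSemidef := by
  refine Matrix.PosSemidef.of_dotProduct_mulVec_nonneg ?_ fun v => ?_
  · ext a b
    simp [momentMatrix, mul_comm]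
  · have := inner_act_eq_dotProduct (momentMatrix f (designMeasure k)) (WithLp.toLp 2 v)
    rw [inner_act_momentMatrix f k hk] at this
    simp only [star_trivial]
    rw [← this]
    positivity

end Moment

section Sqrt

variable {p : ℕ} {M : Matrix (Fin p) (Fin p) ℝ} {c : ℝ}

theorem act_mul (A B : Matrix (Fin p) (Fin p) ℝ) (h : EuclideanSpace ℝ (Fin p)) :
    act (A * B) h = act A (act B h) := by
  simp [act]

theorem act_add (A : Matrix (Fin p) (Fin p) ℝ) (g h : EuclideanSpace ℝ (Fin p)) :
    act A (g + h) = act A g + act A h := map_add _ _ _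

theorem act_sub (A : Matrix (Fin p) (Fin p) ℝ) (g h : EuclideanSpace ℝ (Fin p)) :
    act A (g - h) = act A g - act A h := map_sub _ _ _

theorem act_smul (A : Matrix (Fin p) (Fin p) ℝ) (r : ℝ) (h : EuclideanSpace ℝ (Fin p)) :
    act A (r • h) = r • act A h := map_smul _ _ _

theorem act_one (h : EuclideanSpace ℝ (Fin p)) : act 1 h = h := by
  simp [act]

theorem inner_act_left_of_isHermitian {A : Matrix (Fin p) (Fin p) ℝ} (hA : A.IsHermitian)
    (g h : EuclideanSpace ℝ (Fin p)) : ⟪act A g, h⟫ = ⟪g, act A h⟫ := by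
  have hs : IsSelfAdjoint (Matrix.toEuclideanCLM (𝕜 := ℝ) A) :=
    IsSelfAdjoint.map (f := Matrix.toEuclideanCLM (𝕜 := ℝ)) hA
  exact (ContinuousLinearMap.isSelfAdjoint_iff_isSymmetric.1 hs) g h

theorem le_inner_act_of_spectrum (hM : M.IsHermitian) (hc : ∀ r ∈ spectrum ℝ M, c ≤ r)
    (h : EuclideanSpace ℝ (Fin p)) : c * ‖h‖ ^ 2 ≤ ⟪act M h, h⟫ := by
  have hps : (M - algebraMap ℝ _ c).PosSemidef := by
    rw [← Matrix.nonneg_iff_posSemidef, sub_nonneg]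
    exact (algebraMap_le_iff_le_spectrum (a := M) hM).2 hc
  have h2 := hps.dotProduct_mulVec_nonneg h.ofLp
  simp only [star_trivial] at h2
  rw [← inner_act_eq_dotProduct] at h2
  have h3 : act (M - algebraMap ℝ _ c) h = act M h - c • h := by
    simp [act, Algebra.algebraMap_eq_smul_one]
  rw [h3, inner_sub_left, real_inner_smul_left, real_inner_self_eq_norm_sq] at h2
  linarith

/-- With `c ≤ M` for some `c > 0`, the square root of `M` has an inverse `B`, which satisfies
`B M B = 1` and has norm at most `c^{-1/2}`. -/
theorem exists_inverse_sqrt (hM : M.PosSemidef) (hc : 0 < c)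
    (hsp : ∀ r ∈ spectrum ℝ M, c ≤ r) :
    ∃ B : Matrix (Fin p) (Fin p) ℝ, B.IsHermitian ∧ B * M = CFC.sqrt M ∧ B * M * B = 1 ∧
      M * M⁻¹ = 1 ∧ ∀ h, ‖act B h‖ ≤ (√c)⁻¹ * ‖h‖ := by
  have hM0 : 0 ≤ M := Matrix.nonneg_iff_posSemidef.2 hM
  have hsq : CFC.sqrt M * CFC.sqrt M = M := CFC.sqrt_mul_sqrt_self M hM0
  have hu : IsUnit M := by
    rw [← spectrum.zero_notMem_iff ℝ]
    exact fun h0 => absurd (hsp 0 h0) (not_le.2 hc)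
  have hdet : IsUnit M.det := (Matrix.isUnit_iff_isUnit_det M).1 hu
  have hdets : IsUnit (CFC.sqrt M).det := by
    rw [← hsq, Matrix.det_mul] at hdet
    exact isUnit_of_mul_isUnit_left hdet
  have hherm : (CFC.sqrt M).IsHermitian :=
    (Matrix.nonneg_iff_posSemidef.1 (CFC.sqrt_nonneg M)).1
  have hBS : (CFC.sqrt M)⁻¹ * CFC.sqrt M = 1 := Matrix.nonsing_inv_mul _ hdets
  have hSB : CFC.sqrt M * (CFC.sqrt M)⁻¹ = 1 := Matrix.mul_nonsing_inv _ hdets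
  have hBM : (CFC.sqrt M)⁻¹ * M = CFC.sqrt M := by
    calc (CFC.sqrt M)⁻¹ * M = (CFC.sqrt M)⁻¹ * (CFC.sqrt M * CFC.sqrt M) := by rw [hsq]
      _ = CFC.sqrt M := by rw [← mul_assoc, hBS, one_mul]
  refine ⟨(CFC.sqrt M)⁻¹, hherm.inv, hBM, by rw [hBM, hSB], Matrix.mul_nonsing_inv _ hdet,
    fun h => ?_⟩
  set g := act (CFC.sqrt M)⁻¹ h with hg
  have hgh : act (CFC.sqrt M) g = h := by rw [hg, ← act_mul, hSB, act_one]
  have h1 : c * ‖g‖ ^ 2 ≤ ‖h‖ ^ 2 := by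
    have h2 : ⟪act M g, g⟫ = ‖h‖ ^ 2 := by
      calc ⟪act M g, g⟫ = ⟪act (CFC.sqrt M * CFC.sqrt M) g, g⟫ := by rw [hsq]
        _ = ‖h‖ ^ 2 := by
          rw [act_mul, inner_act_left_of_isHermitian hherm, hgh, real_inner_self_eq_norm_sq]
    exact (le_inner_act_of_spectrum hM.1 hsp g).trans h2.le
  have hsc : 0 < √c := Real.sqrt_pos.2 hc
  have h2 : √c * ‖g‖ ≤ ‖h‖ := by
    refine le_of_sq_le_sq ?_ (norm_nonneg h)
    rwa [mul_pow, Real.sq_sqrt hc.le]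
  rw [inv_mul_eq_div, le_div_iff₀ hsc, mul_comm]
  exact h2

end Sqrt

/-! ### Stochastic linearization of the estimating equation -/

/-- The roots of the estimating equation solve the linearized equation up to an error that is
`o(√n)` in probability. -/
theorem tendsto_measureReal_linearized_root {X : Type*} [Fintype X] {E : Type*}
    [NormedAddCommGroup E] [InnerProductSpace ℝ E]
    {φ : ℝ → ℝ} (hmono : Monotone φ) (hφ : Differentiable ℝ φ)
    (hφ' : Differentiable ℝ (deriv φ)) {m : ℝ} (hm : ∀ t, |deriv (deriv φ) t| ≤ m)
    {ν : Measure ℝ} (h0 : ∫ e, φ e ∂ν = 0)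
    (h2 : Integrable (fun e => φ e ^ 2) ν) {d : ℝ} (hd : 0 < d)
    (hd0 : ∫ e, (deriv φ e - d) ∂ν = 0) (hd2 : Integrable (fun e => (deriv φ e - d) ^ 2) ν)
    {k : ℕ → X → ℕ} (hk : ∀ n, ∑ x, k n x = n)
    {Ω : ℕ → Type*} [∀ n, MeasurableSpace (Ω n)] {P : ∀ n, Measure (Ω n)}
    [∀ n, IsProbabilityMeasure (P n)] {ε : ∀ n, Obs (k n) → Ω n → ℝ}
    (hlaw : ∀ n i, HasLaw (ε n i) ν (P n)) (hind : ∀ n, iIndepFun (ε n) (P n))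
    {f : X → E} {c : ℝ} (hc : 0 < c)
    (hcM : ∀ᶠ n : ℕ in atTop, ∀ h, c * n * ‖h‖ ^ 2 ≤ ∑ x, k n x * ⟪f x, h⟫ ^ 2)
    {τ : ℕ → X → ℝ} {κ : ℝ} (hκ : 0 ≤ κ)
    (hτ : ∀ n : ℕ, 1 ≤ n → ∀ x, |τ n x| ≤ κ / √n) {Δ : ∀ n, Ω n → E}
    (hΔ : ∀ᶠ n in atTop, ∀ᵐ ω ∂(P n),
      ∑ x, ∑ j, φ (ε n ⟨x, j⟩ ω + τ n x - ⟪f x, Δ n ω⟫) • f x = 0)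
    {R : ℝ} (hR : 0 < R) :
    Tendsto (fun n : ℕ => (P n).real {ω | √n * R <
      ‖(∑ x, (∑ j, φ (ε n ⟨x, j⟩ ω)) • f x) +
        d • ∑ x, (k n x * (τ n x - ⟪f x, Δ n ω⟫)) • f x‖}) atTop (𝓝 0) := by
  classical
  rw [Metric.tendsto_atTop']
  intro ζ hζ
  set N : ℝ := (Fintype.card X : ℝ) with hN
  have hN0 : 0 ≤ N := Nat.cast_nonneg _
  set F : ℝ := ∑ x, ‖f x‖ with hFdef
  have hF0 : 0 ≤ F := Finset.sum_nonneg fun x _ => norm_nonneg _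
  have hF : ∀ x, ‖f x‖ ≤ F := fun x =>
    Finset.single_le_sum (f := fun x => ‖f x‖) (fun x _ => norm_nonneg _) (Finset.mem_univ x)
  set v := ∫ e, φ e ^ 2 ∂ν with hv
  have hv0 : 0 ≤ v := integral_nonneg fun e => sq_nonneg _
  set w := ∫ e, (deriv φ e - d) ^ 2 ∂ν with hw
  have hw0 : 0 ≤ w := integral_nonneg fun e => sq_nonneg _
  have hm0 : 0 ≤ m := (abs_nonneg _).trans (hm 0)
  -- `α` controls the sums of the scores with probability close to one, `K` is the resulting
  -- radius, and `ρ` the accuracy that the law of large numbers for `φ'` has to deliver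
  obtain ⟨α, hαp, hα⟩ : ∃ α : ℝ, 0 < α ∧ N * (v / α ^ 2) ≤ ζ / 4 := by
    have ht : Tendsto (fun α : ℝ => N * (v / α ^ 2)) atTop (𝓝 0) := by
      simpa using (Tendsto.div_atTop (tendsto_const_nhds (x := v))
        (tendsto_pow_atTop (α := ℝ) two_ne_zero)).const_mul N
    obtain ⟨α, h1, h2⟩ := ((eventually_gt_atTop 0).and
      (ht.eventually_lt_const (show 0 < ζ / 4 by positivity))).exists
    exact ⟨α, h1, h2.le⟩
  set a := N * F * α with ha
  set K := (a + R + d * κ * F) / (d * c) + 1 with hK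
  have hKp : 0 < K := by positivity
  set U := κ + F * K with hU
  have hU0 : 0 ≤ U := by positivity
  set ρ := R / (2 * (N * F * U + 1)) with hρ
  have hρp : 0 < ρ := by positivity
  have hdom : a + R + d * κ * F < d * c * K := by
    rw [hK, mul_add, mul_div_cancel₀ _ (by positivity : d * c ≠ 0)]
    have : 0 < d * c := by positivity
    linarith
  have hρR : N * F * U * ρ ≤ R / 2 := by
    rw [hρ, mul_div_assoc', div_le_div_iff₀ (by positivity) (by positivity)]
    nlinarith
  have hsm : ∀ᶠ n : ℕ in atTop, F * m * U ^ 2 / √(n : ℝ) < R / 2 :=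
    (Tendsto.div_atTop (tendsto_const_nhds (x := F * m * U ^ 2))
      (Real.tendsto_sqrt_atTop.comp tendsto_natCast_atTop_atTop)).eventually_lt_const
      (by positivity)
  have hQs : ∀ᶠ n : ℕ in atTop, N * (w / ρ ^ 2) / (n : ℝ) < ζ / 4 :=
    (Tendsto.div_atTop (tendsto_const_nhds (x := N * (w / ρ ^ 2)))
      tendsto_natCast_atTop_atTop).eventually_lt_const (by positivity)
  obtain ⟨n₀, hn₀⟩ := eventually_atTop.1
    (hcM.and (hΔ.and (hsm.and (hQs.and (eventually_gt_atTop 0)))))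
  refine ⟨n₀, fun n hn => ?_⟩
  obtain ⟨hcn, hΔn, hsmn, hQn, hnp⟩ := hn₀ n hn.le
  have hnp' : (0 : ℝ) < n := by exact_mod_cast hnp
  have hs : 0 < √(n : ℝ) := Real.sqrt_pos.2 hnp'
  set S : X → Set (Ω n) := fun x => {ω | α * √n ≤ |∑ j, φ (ε n ⟨x, j⟩ ω)|} with hS
  set D : X → Set (Ω n) := fun x => {ω | ρ * n ≤ |∑ j, (deriv φ (ε n ⟨x, j⟩ ω) - d)|} with hD
  have hkn : ∀ x, k n x ≤ n := by
    intro x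
    have : k n x ≤ ∑ x, k n x :=
      Finset.single_le_sum (f := k n) (fun x _ => Nat.zero_le _) (Finset.mem_univ x)
    rwa [hk n] at this
  have hindx : ∀ x, iIndepFun (fun j => ε n ⟨x, j⟩) (P n) := fun x =>
    (hind n).precomp (g := fun j : Fin (k n x) => (⟨x, j⟩ : Obs (k n)))
      (sigma_mk_injective (β := fun x => Fin (k n x)))
  have hSb : ∀ x, (P n).real (S x) ≤ v / α ^ 2 := by
    intro x
    refine (measureReal_sum_ge_le (fun j => hlaw n ⟨x, j⟩) (hindx x) hφ.continuous.measurable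
      h0 h2 Finset.univ (a := α * √n) (by positivity)).trans ?_
    rw [Finset.card_univ, Fintype.card_fin, mul_pow, Real.sq_sqrt hnp'.le]
    calc k n x * v / (α ^ 2 * n) ≤ n * v / (α ^ 2 * n) := by gcongr; exact hkn x
      _ = v / α ^ 2 := by field_simp
  have hDb : ∀ x, (P n).real (D x) ≤ w / ρ ^ 2 / n := by
    intro x
    refine (measureReal_sum_ge_le (φ := fun e => deriv φ e - d) (fun j => hlaw n ⟨x, j⟩)
      (hindx x) (hφ'.continuous.measurable.sub_const d)
      hd0 hd2 Finset.univ (a := ρ * n) (by positivity)).trans ?_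
    rw [Finset.card_univ, Fintype.card_fin, mul_pow]
    calc k n x * w / (ρ ^ 2 * n ^ 2) ≤ n * w / (ρ ^ 2 * n ^ 2) := by gcongr; exact hkn x
      _ = w / ρ ^ 2 / n := by field_simp
  have hsub : ({ω | √n * R < ‖(∑ x, (∑ j, φ (ε n ⟨x, j⟩ ω)) • f x) +
        d • ∑ x, (k n x * (τ n x - ⟪f x, Δ n ω⟫)) • f x‖} : Set (Ω n))
      ≤ᵐ[P n] ((⋃ x, S x) ∪ ⋃ x, D x : Set (Ω n)) := by
    filter_upwards [hΔn] with ω hω hbad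
    by_contra hgood
    have hgood' : ω ∉ (⋃ x, S x) ∪ ⋃ x, D x := hgood
    simp only [hS, hD, Set.mem_union, Set.mem_iUnion, Set.mem_ofPred_eq, not_or, not_exists,
      not_le] at hgood'
    refine not_le.2 hbad (norm_linearized_root_le hmono hφ hφ' hm hd.le hnp (hk n) hF hF0 hcn
      (hτ n hnp) hρp.le hKp (a := a) (by linarith) hdom (e := fun i => ε n i ω) ?_
      (fun x => (hgood'.2 x).le) hω)
    refine (norm_sum_le _ _).trans ?_
    calc ∑ x, ‖(∑ j, φ (ε n ⟨x, j⟩ ω)) • f x‖ ≤ ∑ _x : X, α * √n * F := by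
          refine Finset.sum_le_sum fun x _ => ?_
          rw [norm_smul, Real.norm_eq_abs]
          gcongr
          · exact (hgood'.1 x).le
          · exact hF x
      _ = a * √n := by
          rw [Finset.sum_const, Finset.card_univ, nsmul_eq_mul, ha]; ring
  rw [dist_zero_right, Real.norm_eq_abs, abs_of_nonneg measureReal_nonneg]
  calc _ ≤ (P n).real ((⋃ x, S x) ∪ ⋃ x, D x) :=
        ENNReal.toReal_mono (measure_ne_top _ _) (measure_mono_ae hsub)
    _ ≤ (P n).real (⋃ x, S x) + (P n).real (⋃ x, D x) := measureReal_union_le _ _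
    _ ≤ (∑ x, (P n).real (S x)) + ∑ x, (P n).real (D x) :=
        add_le_add (measureReal_iUnion_fintype_le _) (measureReal_iUnion_fintype_le _)
    _ ≤ (∑ _x : X, v / α ^ 2) + ∑ _x : X, w / ρ ^ 2 / n :=
        add_le_add (Finset.sum_le_sum fun x _ => hSb x) (Finset.sum_le_sum fun x _ => hDb x)
    _ = N * (v / α ^ 2) + N * (w / ρ ^ 2) / n := by
        simp only [Finset.sum_const, Finset.card_univ, nsmul_eq_mul, ← hN]
        ring
    _ < ζ := by linarith

/-! ### Moments of the score -/

theorem integral_odd_eq_zero {ν : Measure ℝ} (hν : ν.map (fun e => -e) = ν) {φ : ℝ → ℝ}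
    (hodd : ∀ t, φ (-t) = -φ t) : ∫ e, φ e ∂ν = 0 := by
  have h : ∫ e, φ e ∂ν = -∫ e, φ e ∂ν := by
    calc ∫ e, φ e ∂ν = ∫ e, φ e ∂(ν.map (MeasurableEquiv.neg ℝ)) := by
          conv_lhs => rw [← hν]
          rfl
      _ = ∫ e, φ (-e) ∂ν := integral_map_equiv _ _
      _ = -∫ e, φ e ∂ν := by simp_rw [hodd, integral_neg]
  linarith

/-! ### The limit law -/

theorem posSemidef_smul_one {p : ℕ} {s : ℝ} (hs : 0 ≤ s) :
    (s • (1 : Matrix (Fin p) (Fin p) ℝ)).PosSemidef :=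
  Matrix.PosSemidef.one.smul hs

theorem charFun_multivariateGaussian_smul_one {p : ℕ} {s : ℝ} (hs : 0 ≤ s)
    (t : EuclideanSpace ℝ (Fin p)) :
    charFun (multivariateGaussian 0 (s • (1 : Matrix (Fin p) (Fin p) ℝ))) t =
      Complex.exp (-((s * ‖t‖ ^ 2 : ℝ) : ℂ) / 2) := by
  rw [charFun_multivariateGaussian (posSemidef_smul_one hs), inner_zero_right,
    Matrix.smul_mulVec, Matrix.one_mulVec, dotProduct_smul, EuclideanSpace.real_norm_sq_eq]
  congr 1
  simp [dotProduct, sq, neg_div]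

end RobustDesign

/-! ### Asymptotic normality -/

theorem theorem1
    -- the finite design space and the `p` regressors, with `A = ∑ f(x) f(x)ᵀ` invertible
    {p q : ℕ} (𝒳 : Finset (EuclideanSpace ℝ (Fin q)))
    (f : 𝒳 → EuclideanSpace ℝ (Fin p))
    (hA : IsUnit (∑ x : 𝒳, Matrix.vecMulVec (f x).ofLp (f x).ofLp))
    -- the designs: `k n x` replicates at `x`, a total of `n` observations
    (k : ℕ → 𝒳 → ℕ) (hk : ∀ n, ∑ x, k n x = n)
    -- the `n`-th response function, the target parameter and the bound on the model error
    (m : ℕ → 𝒳 → ℝ) (θ₀ : EuclideanSpace ℝ (Fin p)) (κ : ℝ)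
    (hθ₀ : ∀ n, 1 ≤ n → IsMinOn
      (fun η : EuclideanSpace ℝ (Fin p) => ∑ x, (m n x - ⟪f x, η⟫) ^ 2) Set.univ θ₀)
    (hτ : ∀ n, 1 ≤ n →
      ∑ x, RobustDesign.modelError f (m n) θ₀ x ^ 2 ≤ κ ^ 2 / n)
    -- for each `n`, i.i.d. errors, with a symmetric law `ν` that does not depend on `n`
    (ν : Measure ℝ) [IsProbabilityMeasure ν] (hν : ν.map (fun e => -e) = ν)
    {Ω : ℕ → Type*} [∀ n, MeasurableSpace (Ω n)] (P : ∀ n, Measure (Ω n))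
    [∀ n, IsProbabilityMeasure (P n)]
    (ε : ∀ n, RobustDesign.Obs (k n) → Ω n → ℝ)
    (hε_law : ∀ n i, HasLaw (ε n i) ν (P n))
    (hε_indep : ∀ n, iIndepFun (ε n) (P n))
    -- the score function `ψ` and the scale `σ`; `ψ_σ'` and `ψ_σ''` are bounded
    (ψ : ℝ → ℝ) (σ : ℝ) (hσ : 0 < σ)
    (hψ_mono : Monotone ψ) (hψ_odd : ∀ t, ψ (-t) = -ψ t)
    (hψ_diff : Differentiable ℝ ψ) (hψ_diff2 : Differentiable ℝ (deriv ψ))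
    (hψ_m1 : ∃ m₁ : ℝ, ∀ t, deriv (RobustDesign.scaledScore ψ σ) t ≤ m₁)
    (hψ_m2 : ∃ m₂ : ℝ, ∀ t, |deriv (deriv (RobustDesign.scaledScore ψ σ)) t| ≤ m₂)
    -- `σ_M²` is finite
    (hψ_sq : Integrable (fun e => RobustDesign.scaledScore ψ σ e ^ 2) ν)
    (hψ_pos : ∫ e, deriv (RobustDesign.scaledScore ψ σ) e ∂ν ≠ 0)
    -- the smallest eigenvalue of `M_{0,n}` is bounded away from zero
    (hM : ∃ c > 0, ∀ᶠ n in atTop, ∀ r ∈ spectrum ℝ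
      (RobustDesign.momentMatrix f (RobustDesign.designMeasure (k n))), c ≤ r)
    -- the designs have a weak limit
    (ξlim : ProbabilityMeasure 𝒳)
    (hξ : Tendsto (fun n => RobustDesign.designMeasure (k n)) atTop (𝓝 ξlim.toFiniteMeasure))
    -- the M-estimate: a random vector that solves the estimating equation, where
    -- `Y_j(x) = m n x + ε_{xj}`
    (θhat : ∀ n, Ω n → EuclideanSpace ℝ (Fin p))
    (hθhat_meas : ∀ n, AEMeasurable (θhat n) (P n))
    (hθhat : ∀ n, ∀ᵐ ω ∂(P n), RobustDesign.mEstimatingFunction ψ σ f (k n)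
      (fun i => m n i.1 + ε n i ω) (θhat n ω) = 0) :
    TendstoInDistribution
      (fun n ω =>
        let ξ := RobustDesign.designMeasure (k n)
        let M := RobustDesign.momentMatrix f ξ
        let b := RobustDesign.biasVector f (RobustDesign.modelError f (m n) θ₀) ξ
        √(n : ℝ) • RobustDesign.act (CFC.sqrt M) (θhat n ω - θ₀ - RobustDesign.act M⁻¹ b))
      atTop
      (id : EuclideanSpace ℝ (Fin p) → EuclideanSpace ℝ (Fin p))
      P
      (multivariateGaussian 0
        (RobustDesign.sigmaMSq ψ σ ν • (1 : Matrix (Fin p) (Fin p) ℝ))) := by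

  set φ := RobustDesign.scaledScore ψ σ with hφdef
  obtain ⟨m₁, hm₁⟩ := hψ_m1
  obtain ⟨m₂, hm₂⟩ := hψ_m2
  obtain ⟨c, hc, hMc⟩ := hM
  -- analytic properties of the rescaled score
  have hmono : Monotone φ := fun s t hst => hψ_mono (by gcongr)
  have hodd : ∀ t, φ (-t) = -φ t := fun t => by
    simp only [hφdef, RobustDesign.scaledScore, neg_div, hψ_odd]
  have hφ : Differentiable ℝ φ := hψ_diff.comp (differentiable_id.div_const σ)
  have hderiv : deriv φ = fun t => deriv ψ (t / σ) / σ := by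
    ext t
    have h := (hψ_diff (t / σ)).hasDerivAt.comp t ((hasDerivAt_id t).div_const σ)
    rw [← mul_one_div]
    exact h.deriv
  have hφ' : Differentiable ℝ (deriv φ) := by
    rw [hderiv]
    exact (hψ_diff2.comp (differentiable_id.div_const σ)).div_const σ
  have hφ'0 : ∀ t, 0 ≤ deriv φ t := fun t => hmono.deriv_nonneg
  -- moments of the score and of its derivative
  have hφmean : ∫ e, φ e ∂ν = 0 := RobustDesign.integral_odd_eq_zero hν hodd
  have hφ'b : ∀ t, ‖deriv φ t‖ ≤ m₁ := fun t => by
    rw [Real.norm_eq_abs, abs_of_nonneg (hφ'0 t)]; exact hm₁ t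
  have hφ'int : Integrable (deriv φ) ν :=
    Integrable.of_bound hφ'.continuous.aestronglyMeasurable m₁ (Eventually.of_forall hφ'b)
  set d := ∫ e, deriv φ e ∂ν with hd
  have hdp : 0 < d := lt_of_le_of_ne (integral_nonneg hφ'0) (Ne.symm hψ_pos)
  have hd0 : ∫ e, (deriv φ e - d) ∂ν = 0 := by
    rw [integral_sub hφ'int (integrable_const _), integral_const, probReal_univ, one_smul,
      sub_self]
  have hd2 : Integrable (fun e => (deriv φ e - d) ^ 2) ν := by
    refine Integrable.of_bound
      ((hφ'.continuous.sub continuous_const).pow 2).aestronglyMeasurable ((m₁ + |d|) ^ 2)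
      (Eventually.of_forall fun t => ?_)
    rw [norm_pow]
    gcongr
    exact (norm_sub_le _ _).trans (by gcongr; exacts [hφ'b t, le_rfl])
  set v := ∫ e, φ e ^ 2 ∂ν with hv
  have hv0 : 0 ≤ v := integral_nonneg fun e => sq_nonneg _
  set τ : ℕ → 𝒳 → ℝ := fun n => RobustDesign.modelError f (m n) θ₀ with hτdef
  have hτb : ∀ n : ℕ, 1 ≤ n → ∀ x, |τ n x| ≤ |κ| / √n := by
    intro n hn x
    have h1 : τ n x ^ 2 ≤ κ ^ 2 / n :=
      (Finset.single_le_sum (f := fun x => τ n x ^ 2) (fun x _ => sq_nonneg _)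
        (Finset.mem_univ x)).trans (hτ n hn)
    rw [← Real.sqrt_sq_eq_abs, ← Real.sqrt_sq_eq_abs κ, ← Real.sqrt_div (sq_nonneg κ)]
    exact Real.sqrt_le_sqrt h1
  set M : ℕ → Matrix (Fin p) (Fin p) ℝ :=
    fun n => RobustDesign.momentMatrix f (RobustDesign.designMeasure (k n)) with hMdef
  have hMps : ∀ n, (M n).PosSemidef := fun n => RobustDesign.posSemidef_momentMatrix f (k n) (hk n)
  -- the inverse square root of `M n`, where it exists
  have hB : ∀ n, ∃ B : Matrix (Fin p) (Fin p) ℝ, (∀ r ∈ spectrum ℝ (M n), c ≤ r) →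
      B.IsHermitian ∧ B * M n = CFC.sqrt (M n) ∧ B * M n * B = 1 ∧ M n * (M n)⁻¹ = 1 ∧
        ∀ h, ‖RobustDesign.act B h‖ ≤ (√c)⁻¹ * ‖h‖ := by
    intro n
    by_cases h : ∀ r ∈ spectrum ℝ (M n), c ≤ r
    · obtain ⟨B, hB⟩ := RobustDesign.exists_inverse_sqrt (hMps n) hc h
      exact ⟨B, fun _ => hB⟩
    · exact ⟨0, fun h' => absurd h' h⟩
  choose B hB using hB
  have hcM : ∀ᶠ n : ℕ in atTop, ∀ h, c * n * ‖h‖ ^ 2 ≤ ∑ x, k n x * ⟪f x, h⟫ ^ 2 := by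
    filter_upwards [hMc, eventually_gt_atTop 0] with n hn hnp h
    have hnp' : (0 : ℝ) < n := by exact_mod_cast hnp
    have h1 := RobustDesign.le_inner_act_of_spectrum (hMps n).1 hn h
    rw [RobustDesign.inner_act_momentMatrix f (k n) (hk n)] at h1
    calc c * n * ‖h‖ ^ 2 = n * (c * ‖h‖ ^ 2) := by ring
      _ ≤ n * ∑ x, ((k n x : ℝ) / n) * ⟪f x, h⟫ ^ 2 := by gcongr
      _ = ∑ x, k n x * ⟪f x, h⟫ ^ 2 := by
        rw [Finset.mul_sum]
        refine Finset.sum_congr rfl fun x _ => ?_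
        field_simp
  -- the leading term, a weighted sum of the scores of the errors
  set g : ∀ n, RobustDesign.Obs (k n) → EuclideanSpace ℝ (Fin p) :=
    fun n i => (d⁻¹ * (√(n : ℝ))⁻¹) • RobustDesign.act (B n) (f i.1) with hg
  set Y : ∀ n, Ω n → EuclideanSpace ℝ (Fin p) := fun n ω => ∑ i, φ (ε n i ω) • g n i with hY
  set W : ∀ n, Ω n → EuclideanSpace ℝ (Fin p) := fun n ω =>
    √(n : ℝ) • RobustDesign.act (CFC.sqrt (M n)) (θhat n ω - θ₀ - RobustDesign.act (M n)⁻¹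
      (RobustDesign.biasVector f (τ n) (RobustDesign.designMeasure (k n)))) with hW
  have hWm : ∀ n, AEMeasurable (W n) (P n) := by
    intro n
    have hcont : Continuous fun y => √(n : ℝ) • RobustDesign.act (CFC.sqrt (M n))
        (y - θ₀ - RobustDesign.act (M n)⁻¹
          (RobustDesign.biasVector f (τ n) (RobustDesign.designMeasure (k n)))) := by
      unfold RobustDesign.act
      fun_prop
    exact hcont.measurable.comp_aemeasurable (hθhat_meas n)
  have hφε : ∀ n i, HasLaw (fun ω => φ (ε n i ω)) (ν.map φ) (P n) := fun n i =>
    { aemeasurable := hφ.continuous.measurable.comp_aemeasurable (hε_law n i).aemeasurable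
      map_eq := by
        rw [← (hε_law n i).map_eq, AEMeasurable.map_map_of_aemeasurable
          hφ.continuous.measurable.aemeasurable (hε_law n i).aemeasurable]
        rfl }
  have hYm : ∀ n, AEMeasurable (Y n) (P n) := fun n =>
    Finset.aemeasurable_fun_sum _ fun i _ => (hφε n i).aemeasurable.smul_const _
  -- convergence of the characteristic functions of the leading term
  have hφprob : IsProbabilityMeasure (ν.map φ) :=
    Measure.isProbabilityMeasure_map hφ.continuous.measurable.aemeasurable
  have hsig : RobustDesign.sigmaMSq ψ σ ν = v / d ^ 2 := rfl
  have hYlim : ∀ t, Tendsto (fun n => charFun ((P n).map (Y n)) t) atTop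
      (𝓝 (charFun (multivariateGaussian 0
        (RobustDesign.sigmaMSq ψ σ ν • (1 : Matrix (Fin p) (Fin p) ℝ))) t)) := by
    intro t
    have hmap0 : ∫ x, x ∂(ν.map φ) = 0 := by
      rw [integral_map hφ.continuous.measurable.aemeasurable (by fun_prop)]
      exact hφmean
    have hmapv : ∫ x, x ^ 2 ∂(ν.map φ) = v :=
      integral_map hφ.continuous.measurable.aemeasurable (by fun_prop)
    have hmap2 : Integrable (fun x => x ^ 2) (ν.map φ) :=
      (integrable_map_measure (by fun_prop) hφ.continuous.measurable.aemeasurable).2 hψ_sq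
    have hgb : ∀ᶠ n : ℕ in atTop, ∀ i, ‖g n i‖ ≤ (d⁻¹ * (√c)⁻¹ * ∑ x, ‖f x‖) / √n := by
      filter_upwards [hMc] with n hn i
      rw [hg, norm_smul, Real.norm_eq_abs, abs_of_nonneg (by positivity)]
      calc d⁻¹ * (√(n : ℝ))⁻¹ * ‖RobustDesign.act (B n) (f i.1)‖
          ≤ d⁻¹ * (√(n : ℝ))⁻¹ * ((√c)⁻¹ * ∑ x, ‖f x‖) := by
            refine mul_le_mul_of_nonneg_left (((hB n hn).2.2.2.2 _).trans ?_) (by positivity)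
            gcongr
            exact Finset.single_le_sum (f := fun x => ‖f x‖) (fun x _ => norm_nonneg _)
              (Finset.mem_univ i.1)
        _ = _ := by ring
    have hq : Tendsto (fun n => ∑ i, ⟪g n i, t⟫ ^ 2) atTop (𝓝 ((d⁻¹) ^ 2 * ‖t‖ ^ 2)) := by
      refine tendsto_const_nhds.congr' ?_
      filter_upwards [hMc] with n hn
      obtain ⟨hBh, -, hBMB, -, -⟩ := hB n hn
      have hnorm : ‖t‖ ^ 2 = ∑ x, ((k n x : ℝ) / n) * ⟪f x, RobustDesign.act (B n) t⟫ ^ 2 := by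
        rw [← RobustDesign.inner_act_momentMatrix f (k n) (hk n),
          ← RobustDesign.inner_act_left_of_isHermitian hBh, ← RobustDesign.act_mul,
          ← RobustDesign.act_mul]
        change ‖t‖ ^ 2 = ⟪RobustDesign.act (B n * M n * B n) t, t⟫
        rw [hBMB, RobustDesign.act_one, real_inner_self_eq_norm_sq]
      rw [hnorm, Fintype.sum_sigma, Finset.mul_sum]
      refine Finset.sum_congr rfl fun x _ => ?_
      simp only [hg, real_inner_smul_left, RobustDesign.inner_act_left_of_isHermitian hBh,
        Finset.sum_const, Finset.card_univ, Fintype.card_fin, nsmul_eq_mul, mul_pow, inv_pow,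
        Real.sq_sqrt (Nat.cast_nonneg n)]
      ring
    have h := RobustDesign.tendsto_charFun_weighted_sum (ν.map φ) hmap0 hmap2 P
      (fun n => by rw [Fintype.card_sigma]; simp only [Fintype.card_fin]; exact (hk n).le)
      (fun n i ω => φ (ε n i ω)) hφε
      (fun n => (hε_indep n).comp (fun _ => φ) fun _ => hφ.continuous.measurable) g hgb t hq
    rw [hmapv] at h
    rw [RobustDesign.charFun_multivariateGaussian_smul_one (by rw [hsig]; positivity), hsig]
    convert h using 3
    push_cast
    ring
  -- the remainder is negligible
  have hlin : ∀ η > 0, Tendsto (fun n => (P n).real {ω | η < ‖W n ω - Y n ω‖}) atTop (𝓝 0) := by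
    intro η hη
    have hsc : 0 < √c := Real.sqrt_pos.2 hc
    have hroot : ∀ᶠ n in atTop, ∀ᵐ ω ∂(P n), ∑ x, ∑ j : Fin (k n x),
        φ (ε n ⟨x, j⟩ ω + τ n x - ⟪f x, θhat n ω - θ₀⟫) • f x = 0 := by
      filter_upwards [eventually_gt_atTop 0] with n hn
      filter_upwards [hθhat n] with ω hω
      rw [RobustDesign.mEstimatingFunction, hk n, smul_eq_zero] at hω
      rw [← hω.resolve_left (by positivity)]
      refine Finset.sum_congr rfl fun x _ => Finset.sum_congr rfl fun j _ => ?_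
      rw [hφdef, hτdef, inner_sub_right]
      simp only [RobustDesign.modelError]
      congr 2
      ring
    refine squeeze_zero' (Eventually.of_forall fun n => measureReal_nonneg) ?_
      (RobustDesign.tendsto_measureReal_linearized_root hmono hφ hφ' hm₂ hφmean hψ_sq hdp hd0 hd2
        hk hε_law hε_indep hc hcM (abs_nonneg κ) hτb hroot (R := η * d * √c) (by positivity))
    filter_upwards [hMc, eventually_gt_atTop 0] with n hn hnp
    have hnp' : (0 : ℝ) < n := by exact_mod_cast hnp
    have hs : 0 < √(n : ℝ) := Real.sqrt_pos.2 hnp'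
    obtain ⟨-, hBM, -, hMM, hBn⟩ := hB n hn
    refine measureReal_mono fun ω hω => ?_
    simp only [Set.mem_ofPred_eq] at hω ⊢
    set Δ := θhat n ω - θ₀ with hΔ
    set S := ∑ x, (∑ j : Fin (k n x), φ (ε n ⟨x, j⟩ ω)) • f x with hS
    set T := ∑ x, ((k n x : ℝ) * (τ n x - ⟪f x, Δ⟫)) • f x with hT
    set b := RobustDesign.biasVector f (τ n) (RobustDesign.designMeasure (k n)) with hb
    have hTb : T = (n : ℝ) • (b - RobustDesign.act (M n) Δ) := by
      rw [hb, RobustDesign.biasVector_designMeasure f (τ n) (k n) (hk n), hMdef,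
        RobustDesign.act_momentMatrix f (k n) (hk n), ← Finset.sum_sub_distrib, Finset.smul_sum]
      refine Finset.sum_congr rfl fun x _ => ?_
      rw [smul_smul, smul_smul, ← sub_smul, smul_smul]
      congr 1
      field_simp
    have hYS : Y n ω = (d⁻¹ * (√(n : ℝ))⁻¹) • RobustDesign.act (B n) S := by
      simp only [hY, hg, Fintype.sum_sigma]
      rw [hS, RobustDesign.act, map_sum, Finset.smul_sum]
      refine Finset.sum_congr rfl fun x _ => ?_
      rw [map_smul, ← Finset.sum_smul, smul_comm]
      rfl
    have hWT : W n ω = -((√(n : ℝ))⁻¹ • RobustDesign.act (B n) T) := by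
      have h1 : RobustDesign.act (M n) (Δ - RobustDesign.act (M n)⁻¹ b)
          = RobustDesign.act (M n) Δ - b := by
        rw [RobustDesign.act_sub, ← RobustDesign.act_mul, hMM, RobustDesign.act_one]
      have h2 : (√(n : ℝ))⁻¹ * n = √n := by
        rw [inv_mul_eq_div, Real.div_sqrt]
      rw [hTb, RobustDesign.act_smul, smul_smul, h2, ← smul_neg,
        ← neg_sub (RobustDesign.act (M n) Δ) b, ← neg_one_smul ℝ (_ - b), RobustDesign.act_smul, neg_one_smul,
        neg_neg, ← h1, ← RobustDesign.act_mul, hBM]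
    have hdiff : W n ω - Y n ω = -((d⁻¹ * (√(n : ℝ))⁻¹) • RobustDesign.act (B n) (S + d • T)) := by
      rw [hWT, hYS, RobustDesign.act_add, RobustDesign.act_smul, smul_add, smul_smul,
        neg_add, mul_right_comm, inv_mul_cancel₀ hdp.ne', one_mul]
      abel
    rw [hdiff, norm_neg, norm_smul, Real.norm_eq_abs, abs_of_nonneg (by positivity)] at hω
    have h3 : η < d⁻¹ * (√(n : ℝ))⁻¹ * ((√c)⁻¹ * ‖S + d • T‖) :=
      hω.trans_le (by gcongr; exact hBn _)
    calc √(n : ℝ) * (η * d * √c)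
        < √(n : ℝ) * (d⁻¹ * (√(n : ℝ))⁻¹ * ((√c)⁻¹ * ‖S + d • T‖) * d * √c) := by gcongr
      _ = ‖S + d • T‖ := by field_simp
  exact
    { forall_aemeasurable := hWm
      aemeasurable_limit := aemeasurable_id
      tendsto := by
        refine ProbabilityMeasure.tendsto_of_tendsto_charFun fun t => ?_
        simp only [ProbabilityMeasure.coe_mk, Measure.map_id]
        exact RobustDesign.tendsto_charFun_of_measureReal_sub P hWm hYm hlin t (hYlim t) }
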